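/- A simple architecture diagram $\langle\mathcal T,n,\mathcal C\rangle$ consists of a finite set $\mathcal T$ of component types, each type $T$ having a set $T.P$ of generic ports (the sets $T.P$ being pairwise disjoint), a cardinality function $n:\mathcal T\to\mathbb N$, and a finite set $\mathcal C$ of connector motifs $\Gamma=(a,\{m_p:d_p\}_{p\in a})$, where $a$ is a finite non-empty subset of $\bigcup_{T\in\mathcal T}T.P$ and, for $p\in a$, the multiplicity $m_p$ is a positive integer and the degree $d_p$ is a natural number; two different motifs of $\mathcal C$ with the same $a$ have different multiplicities for some $p\in a$. For $p\in T.P$ write $n_p=n(T)$. An architecture $\langle\mathcal B,\gamma\rangle$ is a set $\mathcal B$ of components, each having a type $T$ and ports in bijection with $T.P$ (the port corresponding to $p\in T.P$ is called an instance of $p$), together with a set $\gamma$ of connectors, a connector being a set of ports of components in $\mathcal B$. It conforms to the diagram if, for each $T\in\mathcal T$, exactly $n(T)$ components of $\mathcal B$ have type $T$, and $\gamma$ is a disjoint union of sets $\gamma_\Gamma$ $(\Gamma\in\mathcal C)$ such that, for each motif $\Gamma=(a,\{m_p:d_p\}_{p\in a})\in\mathcal C$, every connector in $\gamma_\Gamma$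 consists of instances of generic ports in $a$ only and, for each $p\in a$, contains exactly $m_p$ instances of $p$, and each instance of $p$ lies in exactly $d_p$ connectors of $\gamma_\Gamma$. Proposition. Let $\langle\mathcal T,n,\mathcal C\rangle$ be a simple architecture diagram such that every connector motif $(a,\{m_p:d_p\}_{p\in a})\in\mathcal C$ has some $p\in a$ with $n_p>0$ and $d_p>0$ (in particular, this holds if all cardinalities and degrees are positive). Put $s_p=n_p\cdot d_p/m_p$. The diagram has a conforming architecture if and only if, for each connector motif $(a,\{m_p:d_p\}_{p\in a})\in\mathcal C$ and each $p\in a$, 1. $m_p\le n_p$; 2. $s_p=s_q\in\mathbb N$ for all $q\in a$; 3. $s_p\le\prod_{q\in a}\binom{n_q}{m_q}$. -/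

import Mathlib

namespace ArchDiagram

universe u v

/-- Generic ports. `T` is the collection of component types and `P t` the set of generic ports
of the component type `t`; a generic port belongs to exactly one component type. -/
abbrev GenericPort {T : Type u} (P : T → Type v) : Type (max u v) := Σ t : T, P t

/-- A connector motif `(a, {m_p : d_p}_{p ∈ a})`. -/
structure Motif {T : Type u} (P : T → Type v) where
  /-- the generic connector `a` -/
  ports : Finset (GenericPort P)
  ports_nonempty : ports.Nonempty
  /-- the multiplicities `m_p` -/
  mult : ports → ℕ
  mult_pos : ∀ p, 0 < mult p
  /-- the degrees `d_p` -/
  deg : ports → ℕ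

/-- A simple architecture diagram `⟨𝒯, n, 𝒞⟩`. -/
structure SimpleDiagram {T : Type u} (P : T → Type v) where
  /-- the finite set `𝒯` of component types of the diagram -/
  types : Finset T
  /-- the cardinality function `n` (only its values on `types` matter) -/
  card : T → ℕ
  /-- the finite set `𝒞` of connector motifs -/
  motifs : Finset (Motif P)
  /-- the generic ports of the motifs are ports of the component types of the diagram -/
  ports_mem : ∀ Γ ∈ motifs, ∀ p ∈ Γ.ports, p.1 ∈ types
  /-- two different motifs on the same generic ports differ in some multiplicity -/
  distinguished : ∀ Γ₁ ∈ motifs, ∀ Γ₂ ∈ motifs, Γ₁ ≠ Γ₂ → Γ₁.ports = Γ₂.ports →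
    ∃ (p : GenericPort P) (h₁ : p ∈ Γ₁.ports) (h₂ : p ∈ Γ₂.ports),
      Γ₁.mult ⟨p, h₁⟩ ≠ Γ₂.mult ⟨p, h₂⟩

/-- An architecture `⟨ℬ, γ⟩`: a set of typed components whose ports are in bijective
correspondence with the generic ports of their type, and a set of connectors, each connector
being a set of ports. -/
structure Architecture {T : Type u} (P : T → Type v) where
  /-- the components -/
  Comp : Type u
  /-- the ports of all the components -/
  Port : Type (max u v)
  /-- the type of a component -/
  typeOf : Comp → T
  /-- the component a port belongs to -/
  owner : Port → Comp
  /-- the generic port of which a port is an instance -/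
  generic : Port → GenericPort P
  generic_bijOn : ∀ b, Set.BijOn generic {x | owner x = b} {g | g.1 = typeOf b}
  /-- the configuration `γ` -/
  config : Set (Set Port)

/-- The instances in `A` of a generic port. -/
def Architecture.instances {T : Type u} {P : T → Type v} (A : Architecture P)
    (p : GenericPort P) : Set A.Port := {x | A.generic x = p}

/-- The sub-configuration `γ` meets the connector motif `Γ`: its connectors only involve
instances of the generic ports `p` of `Γ`, each of them exactly `m_p` instances of `p`, and each
instance of `p` is involved in exactly `d_p` of the connectors. -/
def Architecture.MeetsMotif {T : Type u} {P : T → Type v} (A : Architecture P)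
    (Γ : Motif P) (γ : Set (Set A.Port)) : Prop :=
  (∀ c ∈ γ, ∀ x ∈ c, A.generic x ∈ Γ.ports) ∧
  ∀ p : Γ.ports,
    (∀ c ∈ γ, (c ∩ A.instances p).encard = Γ.mult p) ∧
    (∀ x ∈ A.instances p, {c | c ∈ γ ∧ x ∈ c}.encard = Γ.deg p)

/-- The architecture `A` conforms to the diagram `D`. -/
def Architecture.Conforms {T : Type u} {P : T → Type v} (A : Architecture P)
    (D : SimpleDiagram P) : Prop :=
  (∀ t ∈ D.types, {b | A.typeOf b = t}.encard = D.card t) ∧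
  ∃ part : D.motifs → Set (Set A.Port),
    (∀ i j, i ≠ j → Disjoint (part i) (part j)) ∧
    (⋃ i, part i) = A.config ∧
    ∀ i, A.MeetsMotif i.1 (part i)

/-- The cardinality `n_p` of a generic port: that of its component type. -/
def SimpleDiagram.portCard {T : Type u} {P : T → Type v} (D : SimpleDiagram P)
    (p : GenericPort P) : ℕ := D.card p.1

/-- The matching factor `s_p = n_p * d_p / m_p`, a rational number. -/
def SimpleDiagram.matchingFactor {T : Type u} {P : T → Type v} (D : SimpleDiagram P)
    (Γ : Motif P) (p : Γ.ports) : ℚ :=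
  ((D.portCard p : ℚ) * (Γ.deg p : ℚ)) / (Γ.mult p : ℚ)

end ArchDiagram

/-! For a motif, the admissible connectors are the sets with `m_q` instances of each `q`; there are
`∏ (n_q choose m_q)` of them. Counting pairs (instance of `p`, connector) in two ways gives `n_p *
d_p = #γ_Γ * m_p`, so every `s_p` is the number of connectors. It is positive by hypothesis, and a
single connector already forces `m_p ≤ n_p`.

Conversely, the task is to choose `s` admissible sets in which all instances of one generic port
have equal degree (`exists_regular_family`). Among all families of size `s`, take one minimising the
sum of squared degrees. If two instances `a`, `b` of the same port had degrees differing by at least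
two, exchanging `a` and `b` in a suitable member would lower that sum. Motifs can be treated
separately, since a connector determines its motif (`disjoint_of_meetsMotif`). -/

namespace ArchDiagram

open Finset

/-! ### Families of sets with prescribed fibre sizes and regular degrees -/

section Combinatorics

variable {V ι : Type*}

/-- The subsets of `V` having exactly `m i` elements in each fibre `g ⁻¹ i`. -/
def prescribed [Fintype V] [Fintype ι] [DecidableEq ι]
    (g : V → ι) (m : ι → ℕ) : Finset (Finset V) :=
  univ.filter fun c => ∀ i, #{x ∈ c | g x = i} = m i

theorem mem_prescribed [Fintype V] [Fintype ι] [DecidableEq ι]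
    {g : V → ι} {m : ι → ℕ} {c : Finset V} :
    c ∈ prescribed g m ↔ ∀ i, #{x ∈ c | g x = i} = m i := by
  simp [prescribed]

/-- The traces of such a set on the fibres can be chosen independently. -/
theorem card_prescribed [Fintype V] [DecidableEq V] [Fintype ι] [DecidableEq ι]
    (g : V → ι) (m : ι → ℕ) :
    #(prescribed g m) = ∏ i, (#{x | g x = i}).choose (m i) := by
  have h : #(Fintype.piFinset fun i => powersetCard (m i) ({x | g x = i} : Finset V)) =
      ∏ i, (#{x | g x = i}).choose (m i) := by
    simp [Fintype.card_piFinset]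
  rw [← h]
  refine card_nbij' (fun c i => {x ∈ c | g x = i}) (fun f => univ.filter fun x => x ∈ f (g x)) ?_ ?_ ?_ ?_
  · intro c hc
    have hc := mem_prescribed.1 hc
    simp only [mem_coe, Fintype.mem_piFinset, mem_powersetCard]
    exact fun i => ⟨filter_subset_filter _ (subset_univ _), hc i⟩
  · intro f hf
    simp only [mem_coe, Fintype.mem_piFinset, mem_powersetCard] at hf
    refine mem_coe.2 (mem_prescribed.2 fun i => ?_)
    rw [← (hf i).2]
    congr 1
    ext x
    simp only [mem_filter, mem_univ, true_and]
    refine ⟨fun h => h.2 ▸ h.1, fun h => ?_⟩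
    have hx : g x = i := by simpa using (hf i).1 h
    exact ⟨hx ▸ h, hx⟩
  · intro c _
    ext x
    simp
  · intro f hf
    simp only [mem_coe, Fintype.mem_piFinset, mem_powersetCard] at hf
    funext i
    ext x
    simp only [mem_filter, mem_univ, true_and]
    refine ⟨fun h => h.2 ▸ h.1, fun h => ?_⟩
    have hx : g x = i := by simpa using (hf i).1 h
    exact ⟨hx ▸ h, hx⟩

theorem sum_degree_fibre [Fintype V] [DecidableEq V] [Fintype ι] [DecidableEq ι]
    {g : V → ι} {m : ι → ℕ} {F : Finset (Finset V)}
    (hF : F ⊆ prescribed g m) (i : ι) :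
    ∑ x with g x = i, #{c ∈ F | x ∈ c} = #F * m i := by
  have h := sum_card_bipartiteAbove_eq_sum_card_bipartiteBelow
    (s := ({x | g x = i} : Finset V)) (t := F) (fun x c => x ∈ c)
  simp only [bipartiteAbove, bipartiteBelow] at h
  rw [h, ← smul_eq_mul]
  refine sum_const_nat fun c hc => ?_
  rw [← mem_prescribed.1 (hF hc) i]
  congr 1
  ext x
  simp [and_comm]

theorem map_swap_mem_prescribed [Fintype V] [DecidableEq V] [Fintype ι] [DecidableEq ι]
    {g : V → ι} {m : ι → ℕ} {c : Finset V}
    (hc : c ∈ prescribed g m) {a b : V} (hab : g a = g b) :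
    c.map (Equiv.swap a b).toEmbedding ∈ prescribed g m := by
  refine mem_prescribed.2 fun i => ?_
  rw [← mem_prescribed.1 hc i, filter_map, card_map]
  congr 1
  ext x
  have : g (Equiv.swap a b x) = g x := by
    rw [Equiv.swap_apply_def]
    split_ifs with h₁ h₂
    · rw [h₁, hab]
    · rw [h₂, hab]
    · rfl
  simp [this]

theorem mem_map_swap [DecidableEq V] {c : Finset V} {a b z : V} :
    z ∈ c.map (Equiv.swap a b).toEmbedding ↔ Equiv.swap a b z ∈ c := by
  rw [mem_map_equiv, Equiv.symm_swap]

/-- If `a` has larger degree than `b` in `F`, then some member of `F` containing `a` but not `b`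
leaves `F` when `a` and `b` are exchanged. -/
theorem exists_map_swap_notMem [DecidableEq V] {F : Finset (Finset V)} {a b : V}
    (h : #{c ∈ F | b ∈ c} < #{c ∈ F | a ∈ c}) :
    ∃ c ∈ F, a ∈ c ∧ b ∉ c ∧ c.map (Equiv.swap a b).toEmbedding ∉ F := by
  by_contra! hcon
  refine h.not_ge ?_
  -- This map sends members containing `a` to members containing `b`. The two branches cannot
  -- collide: an unchanged set still contains `a`, a swapped one does not.
  refine card_le_card_of_injOn
    (fun c => if b ∈ c then c else c.map (Equiv.swap a b).toEmbedding) ?_ ?_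
  · intro c hc
    simp only [coe_filter, Set.mem_ofPred_eq] at hc ⊢
    split_ifs with hb
    · exact ⟨hc.1, hb⟩
    · exact ⟨hcon c hc.1 hc.2 hb, mem_map_swap.2 (by simpa using hc.2)⟩
  · intro c hc e he hce
    simp only [coe_filter, Set.mem_ofPred_eq] at hc he hce
    split_ifs at hce with hb hb' hb'
    · exact hce
    · refine absurd (mem_map_swap.1 (hce ▸ hc.2)) ?_
      simpa using hb'
    · refine absurd (mem_map_swap.1 (hce ▸ he.2)) ?_
      simpa using hb
    · exact map_injective _ hce

/-- Replacing a member of `F` by its image under the exchange of `a` and `b` moves one unit of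
degree from `a` to `b`, and this lowers the sum of the squares of the degrees. -/
theorem sum_sq_degree_exchange_lt [Fintype V] [DecidableEq V] {F : Finset (Finset V)} {a b : V} {c : Finset V}
    (h : #{c ∈ F | b ∈ c} + 1 < #{c ∈ F | a ∈ c}) (hcF : c ∈ F) (ha : a ∈ c) (hb : b ∉ c)
    (hc' : c.map (Equiv.swap a b).toEmbedding ∉ F) :
    ∑ z, #{e ∈ insert (c.map (Equiv.swap a b).toEmbedding) (F.erase c) | z ∈ e} ^ 2 <
      ∑ z, #{e ∈ F | z ∈ e} ^ 2 := by
  set c' := c.map (Equiv.swap a b).toEmbedding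
  have hab : a ≠ b := fun hab => hb (hab ▸ ha)
  have hdeg : ∀ z, (#{e ∈ insert c' (F.erase c) | z ∈ e} : ℤ) =
      #{e ∈ F | z ∈ e} + ((if z ∈ c' then 1 else 0) - if z ∈ c then 1 else 0) := by
    intro z
    have hn : c' ∉ F.erase c := fun hm => hc' (mem_of_mem_erase hm)
    have h₁ := sum_insert hn (f := fun e => if z ∈ e then (1 : ℤ) else 0)
    have h₂ := add_sum_erase F (fun e => if z ∈ e then (1 : ℤ) else 0) hcF
    simp only [card_filter, Nat.cast_sum, Nat.cast_ite, Nat.cast_one, Nat.cast_zero]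
    rw [h₁, ← h₂]
    ring
  -- The degree drops by one at `a`, grows by one at `b`, and is unchanged elsewhere. The squares
  -- change by `2 + 2 * deg b - 2 * deg a` in total, negative because of the gap of two.
  have hsq : ∀ z, (#{e ∈ insert c' (F.erase c) | z ∈ e} : ℤ) ^ 2 =
      (#{e ∈ F | z ∈ e} : ℤ) ^ 2 + ((if z = a then 1 - 2 * (#{e ∈ F | a ∈ e} : ℤ) else 0) +
        if z = b then 1 + 2 * (#{e ∈ F | b ∈ e} : ℤ) else 0) := by
    intro z
    rw [hdeg]
    have hz : z ∈ c' ↔ Equiv.swap a b z ∈ c := mem_map_swap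
    by_cases hza : z = a
    · subst hza
      simp only [hz, Equiv.swap_apply_left, hb, ha, hab, if_true, if_false]
      ring
    · by_cases hzb : z = b
      · subst hzb
        simp only [hz, Equiv.swap_apply_right, hb, ha, hza, if_true, if_false]
        ring
      · simp only [hz, Equiv.swap_apply_of_ne_of_ne hza hzb, hza, hzb, if_false]
        ring
  zify
  simp only [hsq, sum_add_distrib, sum_ite_eq', mem_univ, if_true]
  have : (#{c ∈ F | b ∈ c} : ℤ) + 1 < #{c ∈ F | a ∈ c} := by exact_mod_cast h
  linarith

theorem exists_regular_family [Fintype V] [DecidableEq V] [Fintype ι] [DecidableEq ι]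
    (g : V → ι) (m d : ι → ℕ) (s : ℕ)
    (hs : s ≤ #(prescribed g m)) (hd : ∀ i, #{x | g x = i} * d i = s * m i) :
    ∃ F ⊆ prescribed g m, #F = s ∧ ∀ x, #{c ∈ F | x ∈ c} = d (g x) := by
  obtain ⟨F, hF, hmin⟩ := exists_min_image (powersetCard s (prescribed g m))
    (fun F => ∑ z, #{e ∈ F | z ∈ e} ^ 2) (powersetCard_nonempty.2 hs)
  obtain ⟨hsub, hcard⟩ := mem_powersetCard.1 hF
  refine ⟨F, hsub, hcard, ?_⟩
  by_contra! hne
  obtain ⟨x, hx⟩ := hne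
  -- The average degree over a fibre is the desired value, so one wrong degree yields both a vertex
  -- above it and a vertex below it.
  have hsum : ∑ y with g y = g x, #{c ∈ F | y ∈ c} = ∑ y with g y = g x, d (g x) := by
    rw [sum_degree_fibre hsub, hcard, ← hd, sum_const, smul_eq_mul]
  have hxm : x ∈ ({y | g y = g x} : Finset V) := by simp
  obtain ⟨a, ha, hda⟩ : ∃ a ∈ ({y | g y = g x} : Finset V), d (g x) < #{c ∈ F | a ∈ c} := by
    by_contra! hle
    exact hx ((sum_eq_sum_iff_of_le hle).1 hsum x hxm)
  obtain ⟨b, hb, hdb⟩ : ∃ b ∈ ({y | g y = g x} : Finset V), #{c ∈ F | b ∈ c} < d (g x) := by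
    by_contra! hle
    exact hx ((sum_eq_sum_iff_of_le hle).1 hsum.symm x hxm).symm
  have hab : g a = g b := by
    rw [(mem_filter.1 ha).2, (mem_filter.1 hb).2]
  obtain ⟨c, hcF, hac, hbc, hc'⟩ := exists_map_swap_notMem (hdb.trans hda)
  -- `d (g x)` lies strictly between the two degrees, hence they differ by at least two.
  refine (sum_sq_degree_exchange_lt (by omega) hcF hac hbc hc').not_ge (hmin _ ?_)
  refine mem_powersetCard.2 ⟨?_, ?_⟩
  · exact insert_subset (map_swap_mem_prescribed (hsub hcF) hab)
      ((erase_subset _ _).trans hsub)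
  · rw [card_insert_of_notMem fun hm => hc' (mem_of_mem_erase hm), card_erase_add_one hcF, hcard]

end Combinatorics

/-! ### Configurations meeting a motif, as finite families -/

section Architecture

variable {T : Type*} {P : T → Type*}

namespace Architecture

variable (A : Architecture P) (Γ : Motif P)

/-- Each component of type `p.1` owns exactly one instance of `p`, so `owner` is a bijection between
the two sets. -/
theorem encard_instances (p : GenericPort P) :
    (A.instances p).encard = {b | A.typeOf b = p.1}.encard := by
  have hinj : Set.InjOn A.owner (A.instances p) := fun x hx y hy hxy =>
    (A.generic_bijOn (A.owner y)).injOn hxy rfl (Eq.trans hx (Eq.symm hy))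
  rw [← hinj.encard_image]
  congr 1
  ext b
  constructor
  · rintro ⟨x, hx, rfl⟩
    have h := (A.generic_bijOn (A.owner x)).mapsTo rfl
    exact (hx ▸ h : p.1 = A.typeOf (A.owner x)).symm
  · intro hb
    obtain ⟨x, hx, hxp⟩ := (A.generic_bijOn b).surjOn (Eq.symm hb : p.1 = A.typeOf b)
    exact ⟨x, hxp, hx⟩

/-- The ports of `A` that are instances of the generic ports of `Γ`. -/
abbrev MotifPort : Type _ := {x : A.Port // A.generic x ∈ Γ.ports}

/-- The generic port of an instance, as a generic port of `Γ`. -/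
def motifGeneric (x : A.MotifPort Γ) : Γ.ports := ⟨A.generic x.1, x.2⟩

variable {A Γ}

theorem finite_motifPort {n : GenericPort P → ℕ}
    (hn : ∀ p ∈ Γ.ports, (A.instances p).encard = n p) : Finite (A.MotifPort Γ) := by
  have h : {x : A.Port | A.generic x ∈ Γ.ports} = ⋃ p ∈ Γ.ports, A.instances p := by
    ext x
    simp [instances]
  refine Set.Finite.to_subtype (s := {x : A.Port | A.generic x ∈ Γ.ports}) ?_
  rw [h]
  exact Γ.ports.finite_toSet.biUnion fun p hp => Set.finite_of_encard_eq_coe (hn p hp)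

/-- A finite set of instances of generic ports of `Γ`, as a set of ports. -/
def connectorOf (c : Finset (A.MotifPort Γ)) : Set A.Port := Subtype.val '' (c : Set (A.MotifPort Γ))

theorem connectorOf_injective :
    Function.Injective (connectorOf : Finset (A.MotifPort Γ) → Set A.Port) :=
  fun _ _ h => coe_injective (Subtype.val_injective.image_injective h)

theorem val_mem_connectorOf {c : Finset (A.MotifPort Γ)} {x : A.MotifPort Γ} :
    x.1 ∈ connectorOf c ↔ x ∈ c := by
  simp [connectorOf, x.2]

theorem encard_connectorOf_inter [DecidableEq Γ.ports] (c : Finset (A.MotifPort Γ)) (p : Γ.ports) :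
    (connectorOf c ∩ A.instances p).encard = #{x ∈ c | A.motifGeneric Γ x = p} := by
  rw [← Set.encard_coe_eq_coe_finsetCard, ← Subtype.val_injective.encard_image]
  congr 1
  ext x
  constructor
  · rintro ⟨⟨y, hy, rfl⟩, h⟩
    exact ⟨y, mem_coe.2 (mem_filter.2 ⟨hy, Subtype.ext h⟩), rfl⟩
  · rintro ⟨y, hy, rfl⟩
    obtain ⟨hy, h⟩ := mem_filter.1 (mem_coe.1 hy)
    exact ⟨⟨y, hy, rfl⟩, congrArg Subtype.val h⟩

theorem card_motifGeneric_fibre [DecidableEq Γ.ports] [Fintype (A.MotifPort Γ)] (p : Γ.ports) :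
    (#{x | A.motifGeneric Γ x = p} : ℕ∞) = (A.instances p).encard := by
  rw [← encard_connectorOf_inter univ p]
  congr 1
  refine Set.inter_eq_right.2 fun x hx => ⟨⟨x, ?_⟩, by simp, rfl⟩
  exact (Eq.symm hx : p.1 = A.generic x) ▸ p.2

theorem encard_connectors_containing [DecidableEq (A.MotifPort Γ)]
    (F : Finset (Finset (A.MotifPort Γ))) (x : A.MotifPort Γ) :
    {c | c ∈ connectorOf '' (F : Set (Finset (A.MotifPort Γ))) ∧ x.1 ∈ c}.encard =
      #{c ∈ F | x ∈ c} := by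
  rw [← Set.encard_coe_eq_coe_finsetCard, ← connectorOf_injective.encard_image]
  congr 1
  ext c
  simp only [coe_filter, Set.mem_image, Set.mem_ofPred_eq, mem_coe]
  constructor
  · rintro ⟨⟨e, he, rfl⟩, h⟩
    exact ⟨e, ⟨he, val_mem_connectorOf.1 h⟩, rfl⟩
  · rintro ⟨e, ⟨he, h⟩, rfl⟩
    exact ⟨⟨e, he, rfl⟩, val_mem_connectorOf.2 h⟩

/-- The bridge to the combinatorial part: cardinalities of sets of ports become `Finset` counts over
the finite type of motif ports. -/
theorem meetsMotif_image_connectorOf_iff [DecidableEq Γ.ports] [Fintype (A.MotifPort Γ)]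
    [DecidableEq (A.MotifPort Γ)] (F : Finset (Finset (A.MotifPort Γ))) :
    A.MeetsMotif Γ (connectorOf '' (F : Set (Finset (A.MotifPort Γ)))) ↔
      F ⊆ prescribed (A.motifGeneric Γ) Γ.mult ∧
        ∀ x, #{c ∈ F | x ∈ c} = Γ.deg (A.motifGeneric Γ x) := by
  constructor
  · rintro ⟨-, h⟩
    refine ⟨fun c hc => mem_prescribed.2 fun p => ?_, fun x => ?_⟩
    · have := (h p).1 _ ⟨c, hc, rfl⟩
      rw [encard_connectorOf_inter] at this
      exact_mod_cast this
    · have := (h (A.motifGeneric Γ x)).2 x.1 rfl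
      rw [encard_connectors_containing] at this
      exact_mod_cast this
  · rintro ⟨hF, hdeg⟩
    refine ⟨?_, fun p => ⟨?_, fun x hx => ?_⟩⟩
    · rintro _ ⟨c, -, rfl⟩ _ ⟨x, -, rfl⟩
      exact x.2
    · rintro _ ⟨c, hc, rfl⟩
      rw [encard_connectorOf_inter, mem_prescribed.1 (hF hc) p]
    · have hx : A.generic x = p := hx
      have hxp : A.generic x ∈ Γ.ports := hx ▸ p.2
      have := encard_connectors_containing F ⟨x, hxp⟩
      rw [this, hdeg, show A.motifGeneric Γ ⟨x, hxp⟩ = p from Subtype.ext hx]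

/-- Connectors meeting a motif consist of motif ports only, so the bridge covers every such
configuration. -/
theorem MeetsMotif.exists_eq_image [Fintype (A.MotifPort Γ)] {γ : Set (Set A.Port)}
    (h : A.MeetsMotif Γ γ) :
    ∃ F : Finset (Finset (A.MotifPort Γ)),
      γ = connectorOf '' (F : Set (Finset (A.MotifPort Γ))) := by
  classical
  refine ⟨univ.filter fun c => connectorOf c ∈ γ, ?_⟩
  ext c
  constructor
  · intro hc
    have hcon : connectorOf (univ.filter fun x : A.MotifPort Γ => x.1 ∈ c) = c := by
      ext x
      simp only [connectorOf, coe_filter, mem_univ, true_and, Set.mem_image, Set.mem_ofPred_eq]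
      exact ⟨by rintro ⟨y, hy, rfl⟩; exact hy, fun hx => ⟨⟨x, h.1 c hc x hx⟩, hx, rfl⟩⟩
    exact ⟨_, by simpa [hcon] using hc, hcon⟩
  · rintro ⟨e, he, rfl⟩
    simpa using he

/-- A nonempty configuration meeting a motif satisfies the counting conditions. -/
theorem MeetsMotif.counting {n : GenericPort P → ℕ}
    (hn : ∀ p ∈ Γ.ports, (A.instances p).encard = n p) {γ : Set (Set A.Port)}
    (h : A.MeetsMotif Γ γ) (hpos : ∃ p : Γ.ports, 0 < n p ∧ 0 < Γ.deg p) :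
    ∃ s : ℕ, (∀ p : Γ.ports, Γ.mult p ≤ n p ∧ n p * Γ.deg p = s * Γ.mult p) ∧
      s ≤ ∏ q : Γ.ports, (n q).choose (Γ.mult q) := by
  classical
  have := finite_motifPort hn
  have := Fintype.ofFinite (A.MotifPort Γ)
  have hfib : ∀ p : Γ.ports, #{x | A.motifGeneric Γ x = p} = n p := fun p => by
    exact_mod_cast (card_motifGeneric_fibre p).trans (hn p p.2)
  obtain ⟨F, rfl⟩ := h.exists_eq_image
  obtain ⟨hF, hdeg⟩ := (meetsMotif_image_connectorOf_iff F).1 h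
  have hcount : ∀ p : Γ.ports, n p * Γ.deg p = #F * Γ.mult p := fun p => by
    rw [← sum_degree_fibre hF p, ← hfib p]
    refine (sum_const_nat fun x hx => ?_).symm
    rw [hdeg, (mem_filter.1 hx).2]
  refine ⟨#F, fun p => ⟨?_, hcount p⟩, ?_⟩
  · obtain ⟨q, hq, hdq⟩ := hpos
    -- An empty family would say nothing about `m_p ≤ n_p`; a positive `n q * deg q` supplies a
    -- connector.
    have hFpos : 0 < #F := by
      refine Nat.pos_of_ne_zero fun h0 => ?_
      have := hcount q
      rw [h0, zero_mul] at this
      exact (Nat.mul_pos hq hdq).ne' this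
    obtain ⟨c, hc⟩ := card_pos.1 hFpos
    rw [← mem_prescribed.1 (hF hc) p, ← hfib p]
    exact card_le_card (filter_subset_filter _ (subset_univ _))
  · refine (card_le_card hF).trans_eq ?_
    rw [card_prescribed]
    exact prod_congr rfl fun q _ => by rw [hfib]

theorem exists_meetsMotif {n : GenericPort P → ℕ}
    (hn : ∀ p ∈ Γ.ports, (A.instances p).encard = n p) {s : ℕ}
    (hs : ∀ p : Γ.ports, n p * Γ.deg p = s * Γ.mult p)
    (hle : s ≤ ∏ q : Γ.ports, (n q).choose (Γ.mult q)) :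
    ∃ γ, A.MeetsMotif Γ γ := by
  classical
  have := finite_motifPort hn
  have := Fintype.ofFinite (A.MotifPort Γ)
  have hfib : ∀ p : Γ.ports, #{x | A.motifGeneric Γ x = p} = n p := fun p => by
    exact_mod_cast (card_motifGeneric_fibre p).trans (hn p p.2)
  obtain ⟨F, hF, -, hdeg⟩ := exists_regular_family (A.motifGeneric Γ) Γ.mult Γ.deg s
    (by rw [card_prescribed]; simpa only [hfib] using hle) (by simpa only [hfib] using hs)
  exact ⟨_, (meetsMotif_image_connectorOf_iff F).2 ⟨hF, hdeg⟩⟩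

/-- Positivity of the multiplicities makes `a` readable from any one connector. -/
theorem MeetsMotif.mem_ports_iff {γ : Set (Set A.Port)} (h : A.MeetsMotif Γ γ) {c : Set A.Port}
    (hc : c ∈ γ) (p : GenericPort P) : p ∈ Γ.ports ↔ (c ∩ A.instances p).Nonempty := by
  constructor
  · intro hp
    rw [← Set.encard_ne_zero, (h.2 ⟨p, hp⟩).1 c hc]
    exact_mod_cast (Γ.mult_pos _).ne'
  · rintro ⟨x, hx, rfl⟩
    exact h.1 c hc x hx

end Architecture

/-! ### Disjointness across motifs and the canonical architecture -/

namespace SimpleDiagram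

variable (D : SimpleDiagram P)

/-- Configurations meeting different motifs of a diagram are disjoint, since a connector
determines its generic ports and their multiplicities. -/
theorem disjoint_of_meetsMotif {A : Architecture P} {Γ₁ Γ₂ : Motif P} (h₁ : Γ₁ ∈ D.motifs)
    (h₂ : Γ₂ ∈ D.motifs) (hne : Γ₁ ≠ Γ₂) {γ₁ γ₂ : Set (Set A.Port)} (hγ₁ : A.MeetsMotif Γ₁ γ₁)
    (hγ₂ : A.MeetsMotif Γ₂ γ₂) : Disjoint γ₁ γ₂ := by
  refine Set.disjoint_left.2 fun c hc₁ hc₂ => ?_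
  have hports : Γ₁.ports = Γ₂.ports := by
    ext p
    rw [hγ₁.mem_ports_iff hc₁, hγ₂.mem_ports_iff hc₂]
  obtain ⟨p, hp₁, hp₂, hmult⟩ := D.distinguished Γ₁ h₁ Γ₂ h₂ hne hports
  refine hmult ?_
  exact_mod_cast ((hγ₁.2 ⟨p, hp₁⟩).1 c hc₁).symm.trans ((hγ₂.2 ⟨p, hp₂⟩).1 c hc₂)

/-- The architecture with exactly `D.card t` components of each type `t` of the diagram, and with
a given configuration. -/
def canonicalArchitecture
    (config : Set (Set (Σ b : (Σ t : D.types, Fin (D.card t)), P b.1))) : Architecture P where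
  Comp := Σ t : D.types, Fin (D.card t)
  Port := Σ b : (Σ t : D.types, Fin (D.card t)), P b.1
  typeOf b := b.1
  owner x := x.1
  generic x := ⟨x.1.1, x.2⟩
  generic_bijOn b := by
    refine ⟨?_, ?_, ?_⟩
    · rintro x rfl
      rfl
    · rintro ⟨_, x⟩ rfl ⟨b', y⟩ hb hxy
      obtain rfl : b' = _ := hb
      simpa using hxy
    · rintro ⟨t, x⟩ ht
      obtain rfl : t = b.1 := ht
      exact ⟨⟨b, x⟩, rfl, rfl⟩
  config := config

theorem encard_canonicalArchitecture
    (config : Set (Set (Σ b : (Σ t : D.types, Fin (D.card t)), P b.1))) {t : T}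
    (ht : t ∈ D.types) :
    {b | (D.canonicalArchitecture config).typeOf b = t}.encard = D.card t := by
  have hinj : Function.Injective
      (fun i => ⟨⟨t, ht⟩, i⟩ : Fin (D.card t) → Σ t : D.types, Fin (D.card t)) :=
    fun i j hij => by simpa using hij
  have h : {b | (D.canonicalArchitecture config).typeOf b = t} =
      (fun i => ⟨⟨t, ht⟩, i⟩ : Fin (D.card t) → Σ t : D.types, Fin (D.card t)) '' Set.univ := by
    ext b
    constructor
    · obtain ⟨⟨t', ht'⟩, i⟩ := b
      intro hb
      obtain rfl : t' = t := hb
      exact ⟨i, trivial, rfl⟩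
    · rintro ⟨i, -, rfl⟩
      rfl
  rw [h]
  exact (hinj.encard_image _).trans (by simp)

variable {D}

theorem encard_instances_of_conforms {A : Architecture P}
    (hA : ∀ t ∈ D.types, {b | A.typeOf b = t}.encard = D.card t) {Γ : Motif P}
    (hΓ : Γ ∈ D.motifs) : ∀ p ∈ Γ.ports, (A.instances p).encard = D.portCard p :=
  fun p hp => (A.encard_instances p).trans (hA _ (D.ports_mem Γ hΓ p hp))

theorem matchingFactor_eq_natCast_iff {Γ : Motif P} {p : Γ.ports} {s : ℕ} :
    D.matchingFactor Γ p = s ↔ D.portCard p * Γ.deg p = s * Γ.mult p := by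
  have : (Γ.mult p : ℚ) ≠ 0 := by exact_mod_cast (Γ.mult_pos p).ne'
  rw [matchingFactor, div_eq_iff this]
  norm_cast

end SimpleDiagram

end Architecture

end ArchDiagram

theorem mainTheorem1 {T : Type*} {P : T → Type*} (D : ArchDiagram.SimpleDiagram P)
    (hpos : ∀ Γ ∈ D.motifs, ∃ p : Γ.ports, 0 < D.portCard p ∧ 0 < Γ.deg p) :
    (∃ A : ArchDiagram.Architecture P, A.Conforms D) ↔
      ∀ Γ ∈ D.motifs, ∀ p : Γ.ports,
        Γ.mult p ≤ D.portCard p ∧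
        (∀ q : Γ.ports, D.matchingFactor Γ p = D.matchingFactor Γ q ∧
          ∃ s : ℕ, D.matchingFactor Γ q = (s : ℚ)) ∧
        D.matchingFactor Γ p ≤
          ((∏ q : Γ.ports, Nat.choose (D.portCard q) (Γ.mult q) : ℕ) : ℚ) := by
  classical
  constructor
  · rintro ⟨A, hA, part, -, -, hmeets⟩ Γ hΓ p
    obtain ⟨s, hs, hle⟩ := (hmeets ⟨Γ, hΓ⟩).counting
      (ArchDiagram.SimpleDiagram.encard_instances_of_conforms hA hΓ) (hpos Γ hΓ)
    have hfac : ∀ q, D.matchingFactor Γ q = s := fun q =>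
      ArchDiagram.SimpleDiagram.matchingFactor_eq_natCast_iff.2 (hs q).2
    refine ⟨(hs p).1, fun q => ⟨(hfac p).trans (hfac q).symm, s, hfac q⟩, ?_⟩
    rw [hfac p]
    exact_mod_cast hle
  · intro h
    have hex : ∀ Γ : D.motifs, ∃ γ, (D.canonicalArchitecture ∅).MeetsMotif Γ.1 γ := by
      rintro ⟨Γ, hΓ⟩
      obtain ⟨p, hp⟩ := Γ.ports_nonempty
      obtain ⟨-, heq, hle⟩ := h Γ hΓ ⟨p, hp⟩
      obtain ⟨s, hs⟩ := (heq ⟨p, hp⟩).2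
      refine ArchDiagram.Architecture.exists_meetsMotif (s := s)
        (ArchDiagram.SimpleDiagram.encard_instances_of_conforms
          (fun t ht => D.encard_canonicalArchitecture ∅ ht) hΓ)
        (fun q => ArchDiagram.SimpleDiagram.matchingFactor_eq_natCast_iff.1
          ((heq q).1.symm.trans hs)) ?_
      rw [hs] at hle
      exact_mod_cast hle
    choose part hpart using hex
    refine ⟨D.canonicalArchitecture (⋃ i, part i),
      fun t ht => D.encard_canonicalArchitecture _ ht, part, fun i j hij => ?_, rfl, hpart⟩
    exact D.disjoint_of_meetsMotif i.2 j.2 (fun hij' => hij (Subtype.ext hij'))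
      (hpart i) (hpart j)
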